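/- Let $n,k$ be integers with $2\le k\le n-2$. For $p\in[0,1]$ let $A(n,k,p)$ be the set of all probability laws on $\{0,1\}^n$ under which the coordinates $X_1,\dots,X_n$ are Bernoulli with mean $p$ and every $k$ of them are independent. Let $M(n,k,p)$ be the maximum of ${\bf P}(X_1=\cdots=X_n=1)$ over ${\bf P}\in A(n,k,p)$; a law attaining it is called optimizing. For an exchangeable law ${\bf P}$ let $v_i={\bf P}(X_1=\cdots=X_i=1,\ X_{i+1}=\cdots=X_n=0)$, $0\le i\le n$. For integers $m\ge l\ge 0$ put $B(m,l,x)=\sum_{i=0}^{l}(-1)^i\binom{m}{i}x^i$. Let $p_1=\frac1{n-k+1}$ and $I=\{0,1,\dots,k-3,k-1,k,n\}$. 1. For some $p_2>p_1$ the following holds for all $p\in[p_1,p_2]$: $$M(n,k,p)=\frac{1}{\binom{n-k+1}{2}}\,p^{k-2}B(n-k+2,2,p),\qquad(\ast)$$ and there is exactly one exchangeable optimizing law; it is given by $$v_i=\begin{cases}p^iB(n-i,k-i,p)+(-1)^{k-i-1}\dfrac{\binom{n-i-1}{k-i}}{\binom{n-k+1}{2}}\,p^{k-2}B(n-k+2,2,p),&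 i\in I\setminus\{n\},\\[2mm] 0,& i\notin I,\\[1mm] \dfrac{1}{\binom{n-k+1}{2}}\,p^{k-2}B(n-k+2,2,p),& i=n.\end{cases}\qquad(\ast\ast)$$ 2. The largest $p_2$ such that $(\ast)$ and $(\ast\ast)$ hold for all $p\in[p_1,p_2]$ is - $\frac{2}{n-1}$ for $k=2$; - $\frac{2}{n-2}$ for $k=3$; - for $k\ge4$, the unique zero in $\left[\frac{1}{n-k+1},\frac{2}{n-k+1}\right]$ of the cubic polynomial $$1-\binom{n-k+3}{1}p+\frac56\binom{n-k+3}{2}p^2-\frac12\binom{n-k+3}{3}p^3 .$$ -/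

import Mathlib

open MeasureTheory ProbabilityTheory

noncomputable section

/-- The set `A(n,k,p)` of all laws of `n` random bits on `{0,1}^n` (with `true` for `1`) whose
coordinates are Bernoulli with mean `p` and `k`-wise independent: every `k` of the coordinates
are independent. -/
def kwiseLaws (n k : ℕ) (p : ℝ) : Set (Measure (Fin n → Bool)) :=
  {P | IsProbabilityMeasure P ∧
    (∀ i : Fin n, P.real {x | x i = true} = p) ∧
    ∀ s : Finset (Fin n), s.card = k →
      iIndepFun (fun (i : s) (x : Fin n → Bool) => x i) P}

/-- The probability that all bits equal `1`. -/
def probAllOnes {n : ℕ} (P : Measure (Fin n → Bool)) : ℝ :=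
  P.real {x | ∀ i, x i = true}

/-- `M(n,k,p)`: the supremum of the probability that all bits equal `1` over `A(n,k,p)`. -/
def maxAllOnes (n k : ℕ) (p : ℝ) : ℝ :=
  sSup (probAllOnes '' kwiseLaws n k p)

/-- A law in `A(n,k,p)` attaining the maximal probability of all ones. -/
def IsOptimizing (n k : ℕ) (p : ℝ) (P : Measure (Fin n → Bool)) : Prop :=
  P ∈ kwiseLaws n k p ∧ ∀ Q ∈ kwiseLaws n k p, probAllOnes Q ≤ probAllOnes P

/-- The bits are exchangeable under `P`: their joint law is invariant under permutations. -/
def IsExchangeableLaw {n : ℕ} (P : Measure (Fin n → Bool)) : Prop :=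
  ∀ σ : Equiv.Perm (Fin n), P.map (fun x i => x (σ i)) = P

/-- `v_i`: the probability that the first `i` bits equal `1` and all the others equal `0`. -/
def cellProb {n : ℕ} (P : Measure (Fin n → Bool)) (i : ℕ) : ℝ :=
  P.real {x | ∀ j : Fin n, x j = true ↔ (j : ℕ) < i}

/-- The Bonferroni polynomial `B(m,l,x)`, the sum of `(-1)^i * C(m,i) * x^i` over `0 ≤ i ≤ l`. -/
def bonferroni (m l : ℕ) (x : ℝ) : ℝ :=
  ∑ i ∈ Finset.range (l + 1), (-1) ^ i * (m.choose i : ℝ) * x ^ i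

/-- The value `p^(k-2) * B(n-k+2,2,p) / C(n-k+1,2)`. -/
def secondValue (n k : ℕ) (p : ℝ) : ℝ :=
  1 / ((n - k + 1).choose 2 : ℝ) * p ^ (k - 2) * bonferroni (n - k + 2) 2 p

/-- `I = {0, …, k-3, k-1, k, n}`. -/
def secondBasis (n k : ℕ) : Finset ℕ :=
  Finset.range (k - 2) ∪ {k - 1, k, n}

/-- The claimed cell probabilities. The exponent of `-1` is an integer, since it is `-1` at
`i = k`. -/
def secondCell (n k : ℕ) (p : ℝ) (i : ℕ) : ℝ :=
  if i = n then secondValue n k p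
  else if i ∈ secondBasis n k then
    p ^ i * bonferroni (n - i) (k - i) p +
      (-1 : ℝ) ^ ((k : ℤ) - (i : ℤ) - 1) *
        (((n - i - 1).choose (k - i) : ℝ) / ((n - k + 1).choose 2 : ℝ)) *
          p ^ (k - 2) * bonferroni (n - k + 2) 2 p
  else 0

/-- At `p`, the maximum `M(n,k,p)` is `secondValue`, and the exchangeable optimizing law exists,
is unique, and has the cell probabilities `secondCell`. -/
def HasSecondForm (n k : ℕ) (p : ℝ) : Prop :=
  maxAllOnes n k p = secondValue n k p ∧
    ∃ P : Measure (Fin n → Bool), IsOptimizing n k p P ∧ IsExchangeableLaw P ∧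
      (∀ i ≤ n, cellProb P i = secondCell n k p i) ∧
      ∀ Q : Measure (Fin n → Bool), IsOptimizing n k p Q → IsExchangeableLaw Q → Q = P

/-- The points `q > 1/(n-k+1)` such that the second form holds on all of `[1/(n-k+1), q]`. -/
def secondEnds (n k : ℕ) : Set ℝ :=
  {q | 1 / ((n : ℝ) - k + 1) < q ∧
    ∀ p ∈ Set.Icc (1 / ((n : ℝ) - k + 1)) q, HasSecondForm n k p}

/-- The cubic polynomial locating the right endpoint for `k ≥ 4`. -/
def secondCubic (n k : ℕ) (p : ℝ) : ℝ :=
  1 - ((n - k + 3).choose 1 : ℝ) * p + 5 / 6 * ((n - k + 3).choose 2 : ℝ) * p ^ 2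
    - 1 / 2 * ((n - k + 3).choose 3 : ℝ) * p ^ 3

end

/-- The coordinates at which a bit string is `true`. -/
def ones {n : ℕ} (x : Fin n → Bool) : Finset (Fin n) :=
  Finset.univ.filter fun i => x i = true

/-- The bit string whose first `i` bits are `true`. -/
def initialOnes (n i : ℕ) : Fin n → Bool := fun j => decide ((j : ℕ) < i)

theorem mem_ones {n : ℕ} {x : Fin n → Bool} {i : Fin n} : i ∈ ones x ↔ x i = true := by
  simp [ones]

theorem card_ones_le {n : ℕ} (x : Fin n → Bool) : (ones x).card ≤ n := by
  simpa using Finset.card_le_univ (ones x)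

theorem card_ones_eq_iff {n : ℕ} (x : Fin n → Bool) :
    (ones x).card = n ↔ ∀ i, x i = true := by
  have h := Finset.card_eq_iff_eq_univ (ones x)
  rw [Fintype.card_fin] at h
  rw [h, Finset.eq_univ_iff_forall]
  simp [mem_ones]

theorem card_ones_initialOnes {n i : ℕ} (h : i ≤ n) : (ones (initialOnes n i)).card = i := by
  have : ones (initialOnes n i) = Finset.univ.filter fun j : Fin n => (j : ℕ) < i := by
    ext j; simp [mem_ones, initialOnes]
  rw [this, Fin.card_filter_val_lt, min_eq_right h]

theorem cellProb_eq {n : ℕ} (P : Measure (Fin n → Bool)) (i : ℕ) :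
    cellProb P i = P.real {initialOnes n i} := by
  unfold cellProb
  congr 1
  ext x
  rw [Set.mem_ofPred_eq, Set.mem_singleton_iff, funext_iff]
  refine forall_congr' fun j => ?_
  rw [Bool.eq_iff_iff (b := initialOnes n i j), initialOnes, decide_eq_true_eq]

theorem exists_perm_comp_eq {n : ℕ} {x y : Fin n → Bool} (h : (ones x).card = (ones y).card) :
    ∃ σ : Equiv.Perm (Fin n), (fun i => y (σ i)) = x := by
  classical
  let e : {i // x i = true} ≃ {i // y i = true} :=
    Fintype.equivOfCardEq (by simpa [Fintype.card_subtype, ones] using h)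
  refine ⟨e.extendSubtype, funext fun i => ?_⟩
  by_cases hi : x i = true
  · rw [hi]; exact e.extendSubtype_mem i hi
  · have := e.extendSubtype_not_mem i hi
    rw [Bool.not_eq_true] at hi this
    rw [hi, this]

theorem real_eq_sum {n : ℕ} (P : Measure (Fin n → Bool)) [IsFiniteMeasure P]
    (q : (Fin n → Bool) → Prop) [DecidablePred q] :
    P.real {x | q x} = ∑ x, if q x then P.real {x} else 0 := by
  rw [← Finset.sum_filter, sum_measureReal_singleton]
  simp

theorem IsExchangeableLaw.real_singleton {n : ℕ} {P : Measure (Fin n → Bool)}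
    (h : IsExchangeableLaw P) (x : Fin n → Bool) :
    P.real {x} = cellProb P (ones x).card := by
  obtain ⟨σ, hσ⟩ := exists_perm_comp_eq (card_ones_initialOnes (card_ones_le x))
  rw [cellProb_eq]
  have hm : Measurable fun (x : Fin n → Bool) i => x (σ i) := measurable_of_finite _
  have key : P {initialOnes n (ones x).card} = P {x} := by
    conv_lhs => rw [← h σ, Measure.map_apply hm (measurableSet_singleton _)]
    congr 1
    ext y
    simp only [Set.mem_preimage, Set.mem_singleton_iff, ← hσ]
    constructor
    · intro hy
      funext i
      simpa using congrFun hy (σ.symm i)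
    · rintro rfl; rfl
  simp [Measure.real, key]

theorem sum_powerset_compl_eq {n : ℕ} (T : Finset (Fin n)) (f : ℕ → ℝ) :
    (∑ x : Fin n → Bool, if T ⊆ ones x then f (ones x).card else 0) =
      ∑ b ∈ Finset.range (n - T.card + 1), ((n - T.card).choose b : ℝ) * f (T.card + b) := by
  have hc : (Tᶜ).card = n - T.card := by simp [Finset.card_compl]
  rw [← Finset.sum_filter]
  have := Finset.sum_powerset_apply_card (fun b => f (T.card + b)) (x := Tᶜ)
  simp only [hc, nsmul_eq_mul] at this
  rw [← this]
  refine Finset.sum_bij' (fun x _ => ones x \ T) (fun B _ => fun i => decide (i ∈ T ∪ B))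
    ?_ ?_ ?_ ?_ ?_
  · intro x _
    simp only [Finset.mem_powerset]
    intro i hi
    simp only [Finset.mem_sdiff] at hi
    simpa using hi.2
  · intro B _
    simp only [Finset.mem_filter, Finset.mem_univ, true_and]
    intro i hi
    simp [mem_ones, hi]
  · intro x hx
    simp only [Finset.mem_filter, Finset.mem_univ, true_and] at hx
    funext i
    rw [Finset.union_sdiff_of_subset hx]
    simp [mem_ones]
  · intro B hB
    ext i
    simp only [Finset.mem_sdiff, mem_ones, decide_eq_true_eq, Finset.mem_union]
    have : i ∈ B → i ∉ T := fun h => Finset.mem_compl.1 (Finset.mem_powerset.1 hB h)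
    tauto
  · intro x hx
    simp only [Finset.mem_filter, Finset.mem_univ, true_and] at hx
    rw [Finset.card_sdiff_of_subset hx, Nat.add_sub_cancel' (Finset.card_le_card hx)]

theorem real_subset_ones_of_mem {n k : ℕ} {p : ℝ} {P : Measure (Fin n → Bool)} (hkn : k ≤ n)
    (hP : P ∈ kwiseLaws n k p) {T : Finset (Fin n)} (hT : T.card ≤ k) :
    P.real {x | T ⊆ ones x} = p ^ T.card := by
  obtain ⟨hprob, hmean, hind⟩ := hP
  obtain ⟨s, hTs, hs⟩ := Finset.exists_superset_card_eq hT (by simpa using hkn)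
  have h := (hind s hs).measure_inter_preimage_eq_mul (T.subtype (· ∈ s))
    (sets := fun _ => {true}) (fun _ _ => measurableSet_singleton _)
  have hset : (⋂ i ∈ T.subtype (· ∈ s), (fun x : Fin n → Bool => x i) ⁻¹' {true}) =
      {x | T ⊆ ones x} := by
    ext x
    simp only [Set.mem_iInter, Set.mem_preimage, Set.mem_singleton_iff, Finset.mem_subtype,
      Set.mem_ofPred_eq, Subtype.forall, Finset.subset_iff, mem_ones]
    exact ⟨fun h i hi => h i (hTs hi) hi, fun h i _ hi => h hi⟩
  rw [hset] at h
  rw [Measure.real, h, ENNReal.toReal_prod]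
  have hm : ∀ i : s, (P ((fun x : Fin n → Bool => x i) ⁻¹' {true})).toReal = p := fun i => hmean i
  simp only [hm, Finset.prod_const, Finset.card_subtype]
  congr 2
  exact Finset.filter_true_of_mem fun i hi => hTs hi

theorem mem_kwiseLaws_of_real_subset_ones {n k : ℕ} {p : ℝ} {P : Measure (Fin n → Bool)}
    [IsProbabilityMeasure P] (hk : 1 ≤ k)
    (h : ∀ T : Finset (Fin n), T.card ≤ k → P.real {x | T ⊆ ones x} = p ^ T.card) :
    P ∈ kwiseLaws n k p := by
  have hmean : ∀ i : Fin n, P.real {x | x i = true} = p := fun i => by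
    simpa [mem_ones] using h {i} (by simpa using hk)
  refine ⟨inferInstance, hmean, fun s hs => ?_⟩
  have hset : iIndepSet (fun i : s => {x : Fin n → Bool | x i = true}) P := by
    rw [iIndepSet_iff_meas_biInter fun i => (Set.toFinite _).measurableSet]
    intro t
    have hinter : (⋂ i ∈ t, {x : Fin n → Bool | x i = true}) =
        {x | t.map (Function.Embedding.subtype _) ⊆ ones x} := by
      ext x
      simp [Finset.subset_iff, mem_ones]
    have hcard : (t.map (Function.Embedding.subtype (· ∈ s))).card = t.card := Finset.card_map _
    have hle : t.card ≤ k := by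
      rw [← hs]; simpa using Finset.card_le_univ t
    rw [← ENNReal.toReal_eq_toReal_iff' (by finiteness)
      (ENNReal.prod_ne_top fun i _ => by finiteness), ENNReal.toReal_prod, hinter]
    have hm : ∀ i : s, (P {x : Fin n → Bool | x i = true}).toReal = p := fun i => hmean i
    have := h (t.map (Function.Embedding.subtype _)) (hcard.trans_le hle)
    rw [Measure.real] at this
    rw [this, hcard]
    simp [hm]
  have hind := (hset.iIndepFun_indicator (β := ℕ)).comp (fun _ a => decide (a = 1))
    fun _ => measurable_of_countable _
  convert hind using 2 with i
  ext x
  by_cases hx : x i = true <;> simp [Set.indicator, hx]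

/-- The measure on bit strings whose weights depend only on the number of ones. -/
noncomputable def cellLaw (n : ℕ) (v : ℕ → ℝ) : Measure (Fin n → Bool) :=
  ∑ x, ENNReal.ofReal (v (ones x).card) • Measure.dirac x

instance (n : ℕ) (v : ℕ → ℝ) : IsFiniteMeasure (cellLaw n v) := by
  unfold cellLaw
  refine ⟨?_⟩
  simp only [Measure.coe_finsetSum, Finset.sum_apply, Measure.smul_apply, smul_eq_mul]
  refine ENNReal.sum_lt_top.2 fun x _ => ?_
  simp

theorem cellLaw_singleton {n : ℕ} (v : ℕ → ℝ) (x : Fin n → Bool) :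
    cellLaw n v {x} = ENNReal.ofReal (v (ones x).card) := by
  classical
  simp [cellLaw, Set.indicator]

theorem cellLaw_real_singleton {n : ℕ} {v : ℕ → ℝ} (hv : ∀ i ≤ n, 0 ≤ v i) (x : Fin n → Bool) :
    (cellLaw n v).real {x} = v (ones x).card := by
  rw [Measure.real, cellLaw_singleton, ENNReal.toReal_ofReal (hv _ (card_ones_le x))]

theorem isExchangeableLaw_cellLaw (n : ℕ) (v : ℕ → ℝ) : IsExchangeableLaw (cellLaw n v) := by
  intro σ
  refine Measure.ext_of_singleton fun x => ?_
  have hm : Measurable fun (x : Fin n → Bool) i => x (σ i) := measurable_of_finite _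
  have hpre : (fun (x : Fin n → Bool) i => x (σ i)) ⁻¹' {x} = {fun i => x (σ.symm i)} := by
    ext y
    simp only [Set.mem_preimage, Set.mem_singleton_iff]
    constructor
    · rintro rfl; simp
    · rintro rfl; simp
  rw [Measure.map_apply hm (measurableSet_singleton _), hpre, cellLaw_singleton, cellLaw_singleton]
  congr 2
  refine Finset.card_bij (fun i _ => σ.symm i) ?_ ?_ ?_
  · intro i hi; simpa [mem_ones] using hi
  · intro i _ j _ hij; exact σ.symm.injective hij
  · intro j hj
    exact ⟨σ j, by simpa [mem_ones] using hj, by simp⟩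

theorem cellProb_cellLaw {n : ℕ} {v : ℕ → ℝ} (hv : ∀ i ≤ n, 0 ≤ v i) {i : ℕ} (hi : i ≤ n) :
    cellProb (cellLaw n v) i = v i := by
  rw [cellProb_eq, cellLaw_real_singleton hv, card_ones_initialOnes hi]

theorem cellLaw_mem_kwiseLaws {n k : ℕ} {p : ℝ} {v : ℕ → ℝ} (hk : 1 ≤ k)
    (hv : ∀ i ≤ n, 0 ≤ v i)
    (hmom : ∀ j ≤ k,
      ∑ b ∈ Finset.range (n - j + 1), ((n - j).choose b : ℝ) * v (j + b) = p ^ j) :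
    cellLaw n v ∈ kwiseLaws n k p := by
  have h : ∀ T : Finset (Fin n), T.card ≤ k →
      (cellLaw n v).real {x | T ⊆ ones x} = p ^ T.card := by
    intro T hT
    rw [real_eq_sum, ← hmom _ hT, ← sum_powerset_compl_eq]
    simp only [cellLaw_real_singleton hv]
  have hprob : IsProbabilityMeasure (cellLaw n v) := by
    refine ⟨?_⟩
    have := h ∅ (by simp)
    simp only [Finset.empty_subset, Set.ofPred_true, Finset.card_empty, pow_zero, Measure.real,
      ENNReal.toReal_eq_one_iff] at this
    exact this
  exact mem_kwiseLaws_of_real_subset_ones hk h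

/-- The cell probabilities of an exchangeable law have binomial moments `p ^ j`. -/
theorem sum_choose_mul_cellProb {n k : ℕ} {p : ℝ} {P : Measure (Fin n → Bool)} (hkn : k ≤ n)
    (hP : P ∈ kwiseLaws n k p) (hex : IsExchangeableLaw P) {j : ℕ} (hj : j ≤ k) :
    ∑ b ∈ Finset.range (n - j + 1), ((n - j).choose b : ℝ) * cellProb P (j + b) = p ^ j := by
  have := hP.1
  obtain ⟨T, -, hT⟩ := Finset.exists_subset_card_eq (s := (Finset.univ : Finset (Fin n)))
    (n := j) (by simpa using hj.trans hkn)
  have h1 := sum_powerset_compl_eq T (cellProb P)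
  rw [hT] at h1
  rw [← h1, ← hT, ← real_subset_ones_of_mem hkn hP (hT.trans_le hj), real_eq_sum]
  simp only [hex.real_singleton]

/-- The weights of the high cells determine an exchangeable law. -/
theorem exchangeable_eq_of_cellProb_eq {n k : ℕ} {p : ℝ} {P Q : Measure (Fin n → Bool)}
    (hkn : k ≤ n) (hP : P ∈ kwiseLaws n k p) (hPex : IsExchangeableLaw P)
    (hQ : Q ∈ kwiseLaws n k p) (hQex : IsExchangeableLaw Q)
    (h : ∀ i ≤ n, k < i → cellProb P i = cellProb Q i) : P = Q := by
  have := hP.1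
  have := hQ.1
  have hall : ∀ d i, i ≤ n → n ≤ i + d → cellProb P i = cellProb Q i := by
    intro d
    induction d with
    | zero =>
      intro i hi hd
      by_cases hik : k < i
      · exact h i hi hik
      · have e1 := sum_choose_mul_cellProb hkn hP hPex (not_lt.1 hik)
        have e2 := sum_choose_mul_cellProb hkn hQ hQex (not_lt.1 hik)
        obtain rfl : i = n := by omega
        simp only [Nat.sub_self, zero_add, Finset.sum_range_one, Nat.choose_self, Nat.cast_one,
          one_mul, add_zero] at e1 e2
        rw [e1, e2]
    | succ d ih =>
      intro i hi hd
      by_cases hik : k < i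
      · exact h i hi hik
      · have e1 := sum_choose_mul_cellProb hkn hP hPex (not_lt.1 hik)
        have e2 := sum_choose_mul_cellProb hkn hQ hQex (not_lt.1 hik)
        rw [Finset.sum_range_succ'] at e1 e2
        have e3 : ∑ b ∈ Finset.range (n - i),
            ((n - i).choose (b + 1) : ℝ) * cellProb P (i + (b + 1)) =
            ∑ b ∈ Finset.range (n - i),
            ((n - i).choose (b + 1) : ℝ) * cellProb Q (i + (b + 1)) := by
          refine Finset.sum_congr rfl fun b hb => ?_
          rw [Finset.mem_range] at hb
          rw [ih (i + (b + 1)) (by omega) (by omega)]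
        simp only [Nat.choose_zero_right, Nat.cast_one, one_mul, add_zero] at e1 e2
        linarith
  refine Measure.ext_of_singleton fun x => ?_
  have hx : P.real {x} = Q.real {x} := by
    rw [hPex.real_singleton, hQex.real_singleton]
    exact hall n _ (card_ones_le x) (by omega)
  exact (ENNReal.toReal_eq_toReal_iff' (by finiteness) (by finiteness)).1 hx

/-- The binomial moments of the number of ones under a `k`-wise independent law. -/
theorem sum_real_mul_choose {n k : ℕ} {p : ℝ} {P : Measure (Fin n → Bool)} (hkn : k ≤ n)
    (hP : P ∈ kwiseLaws n k p) {j : ℕ} (hj : j ≤ k) :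
    ∑ x, P.real {x} * ((ones x).card.choose j : ℝ) = (n.choose j : ℝ) * p ^ j := by
  have := hP.1
  have h1 : ∀ x : Fin n → Bool, P.real {x} * ((ones x).card.choose j : ℝ) =
      ∑ T ∈ Finset.powersetCard j (Finset.univ : Finset (Fin n)),
        if T ⊆ ones x then P.real {x} else 0 := by
    intro x
    rw [← Finset.sum_filter, Finset.sum_const, nsmul_eq_mul, mul_comm,
      ← Finset.card_powersetCard j (ones x)]
    congr 3
    ext T
    simp [Finset.mem_powersetCard, and_comm]
  simp only [h1]
  rw [Finset.sum_comm]
  have h2 : ∀ T ∈ Finset.powersetCard j (Finset.univ : Finset (Fin n)),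
      (∑ x, if T ⊆ ones x then P.real {x} else 0) = p ^ j := by
    intro T hT
    rw [Finset.mem_powersetCard] at hT
    rw [← real_eq_sum, real_subset_ones_of_mem hkn hP (hT.2.trans_le hj), hT.2]
  rw [Finset.sum_congr rfl h2, Finset.sum_const, Finset.card_powersetCard, nsmul_eq_mul,
    Finset.card_fin]

theorem bonferroni_succ_right (m l : ℕ) (x : ℝ) :
    bonferroni m (l + 1) x = bonferroni m l x + (-1) ^ (l + 1) * (m.choose (l + 1) : ℝ) * x ^ (l + 1) :=
  Finset.sum_range_succ _ _

theorem bonferroni_zero_right (m : ℕ) (x : ℝ) : bonferroni m 0 x = 1 := by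
  simp [bonferroni]

theorem bonferroni_two_right (m : ℕ) (x : ℝ) :
    bonferroni m 2 x = 1 - m * x + m * (m - 1) / 2 * x ^ 2 := by
  simp [bonferroni, Finset.sum_range_succ, Nat.cast_choose_two]
  ring

theorem bonferroni_succ_one (m l : ℕ) : bonferroni (m + 1) l 1 = (-1) ^ l * (m.choose l : ℝ) := by
  have := Int.alternating_sum_range_choose_eq_choose (n := m) (m := l)
  simp only [bonferroni, one_pow, mul_one]
  exact_mod_cast this

theorem sum_choose_mul_bonferroni {N K : ℕ} (x : ℝ) :
    ∑ b ∈ Finset.range (K + 1), (N.choose b : ℝ) * (x ^ b * bonferroni (N - b) (K - b) x) = 1 := by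
  induction K with
  | zero => simp [bonferroni]
  | succ K ih =>
    have hterm : ∀ b ∈ Finset.range (K + 1 + 1),
        (N.choose b : ℝ) * (x ^ b * bonferroni (N - b) (K + 1 - b) x) =
        (if b < K + 1 then (N.choose b : ℝ) * (x ^ b * bonferroni (N - b) (K - b) x) else 0) +
          (N.choose (K + 1) : ℝ) * x ^ (K + 1) *
            (1 ^ b * (-1) ^ (K + 1 - b) * ((K + 1).choose b : ℝ)) := by
      intro b hb
      rw [Finset.mem_range] at hb
      have hb' : b ≤ K + 1 := by omega
      have hch : (N.choose (K + 1) : ℝ) * ((K + 1).choose b : ℝ) =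
          (N.choose b : ℝ) * ((N - b).choose (K + 1 - b) : ℝ) := by
        exact_mod_cast Nat.choose_mul hb'
      split_ifs with h
      · have e : K + 1 - b = (K - b) + 1 := by omega
        have hx : x ^ (K + 1) = x ^ b * x ^ (K - b + 1) := by
          rw [← pow_add]; congr 1; omega
        rw [e] at hch ⊢
        rw [bonferroni_succ_right, hx]
        linear_combination -(x ^ b * x ^ (K - b + 1) * (-1) ^ (K - b + 1)) * hch
      · obtain rfl : b = K + 1 := by omega
        simp [bonferroni_zero_right]
    rw [Finset.sum_congr rfl hterm, Finset.sum_add_distrib, ← Finset.mul_sum, ← add_pow,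
      Finset.sum_range_succ, if_neg (lt_irrefl _)]
    have h2 : ∑ b ∈ Finset.range (K + 1), (if b < K + 1 then
        (N.choose b : ℝ) * (x ^ b * bonferroni (N - b) (K - b) x) else 0) = 1 := by
      rw [← ih]
      exact Finset.sum_congr rfl fun b hb => if_pos (Finset.mem_range.1 hb)
    rw [h2]
    simp

theorem mem_secondBasis {n k i : ℕ} :
    i ∈ secondBasis n k ↔ i < k - 2 ∨ i = k - 1 ∨ i = k ∨ i = n := by
  simp only [secondBasis, Finset.mem_union, Finset.mem_range, Finset.mem_insert,
    Finset.mem_singleton]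

theorem secondCell_last (n k : ℕ) (p : ℝ) : secondCell n k p n = secondValue n k p := by
  simp [secondCell]

theorem secondCell_of_lt {n k i : ℕ} (hk : 2 ≤ k) (p : ℝ) (hki : k < i) (hin : i < n) :
    secondCell n k p i = 0 := by
  have hI : i ∉ secondBasis n k := by
    rw [mem_secondBasis]; omega
  simp [secondCell, hin.ne, hI]

theorem secondCell_of_le {n k i : ℕ} (hk : 2 ≤ k) (hkn : k + 2 ≤ n) (p : ℝ) (hik : i ≤ k) :
    secondCell n k p i = p ^ i * bonferroni (n - i) (k - i) p -
      secondValue n k p * bonferroni (n - i) (k - i) 1 := by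
  have hin : i ≠ n := by omega
  have hb1 : bonferroni (n - i) (k - i) 1 = (-1) ^ (k - i) * ((n - i - 1).choose (k - i) : ℝ) := by
    rw [← bonferroni_succ_one]; congr 1; omega
  rw [secondCell, if_neg hin, hb1]
  split_ifs with hI
  · have hz : (-1 : ℝ) ^ ((k : ℤ) - (i : ℤ) - 1) = -(-1) ^ (k - i) := by
      rw [zpow_sub_one₀ (by norm_num), ← Nat.cast_sub hik, zpow_natCast]
      norm_num
    rw [hz, secondValue]
    ring
  · rw [mem_secondBasis] at hI
    obtain ⟨d, rfl⟩ : ∃ d, k = d + 2 := ⟨k - 2, by omega⟩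
    obtain rfl : i = d := by omega
    have e1 : n - (i + 2) + 2 = n - i := by omega
    have e2 : n - (i + 2) + 1 = n - i - 1 := by omega
    have hpos : ((n - i - 1).choose 2 : ℝ) ≠ 0 := by
      exact_mod_cast (Nat.choose_pos (by omega)).ne'
    rw [secondValue, e1, e2, Nat.add_sub_cancel_left, Nat.add_sub_cancel]
    field_simp
    ring

theorem sum_choose_mul_secondCell {n k j : ℕ} (hk : 2 ≤ k) (hkn : k + 2 ≤ n) (p : ℝ) (hj : j ≤ k) :
    ∑ b ∈ Finset.range (n - j + 1), ((n - j).choose b : ℝ) * secondCell n k p (j + b) = p ^ j := by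
  rw [Finset.sum_range_succ, Nat.add_sub_cancel' (by omega), secondCell_last, Nat.choose_self]
  have hsub : ∑ b ∈ Finset.range (n - j), ((n - j).choose b : ℝ) * secondCell n k p (j + b) =
      ∑ b ∈ Finset.range (k - j + 1), ((n - j).choose b : ℝ) * secondCell n k p (j + b) := by
    symm
    refine Finset.sum_subset (fun b hb => ?_) fun b hb hb' => ?_
    · rw [Finset.mem_range] at hb ⊢; omega
    · rw [Finset.mem_range] at hb hb'
      rw [secondCell_of_lt hk p (by omega) (by omega), mul_zero]
  have hterm : ∀ b ∈ Finset.range (k - j + 1),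
      ((n - j).choose b : ℝ) * secondCell n k p (j + b) =
      p ^ j * (((n - j).choose b : ℝ) * (p ^ b * bonferroni (n - j - b) (k - j - b) p)) -
      secondValue n k p *
        (((n - j).choose b : ℝ) * (1 ^ b * bonferroni (n - j - b) (k - j - b) 1)) := by
    intro b hb
    rw [Finset.mem_range] at hb
    rw [secondCell_of_le hk hkn p (by omega), Nat.sub_sub, Nat.sub_sub]
    ring
  rw [hsub, Finset.sum_congr rfl hterm, Finset.sum_sub_distrib, ← Finset.mul_sum, ← Finset.mul_sum,
    sum_choose_mul_bonferroni, sum_choose_mul_bonferroni]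
  simp

/-- The dual polynomial `C(s,k-2) (s-k+1) (s-k)`, vanishing on `{0, …, k-3, k-1, k}`. -/
def dualPoly (k s : ℕ) : ℝ := (s.choose (k - 2) : ℝ) * ((s : ℝ) - k + 1) * ((s : ℝ) - k)

theorem dualPoly_add_two (d s : ℕ) : dualPoly (d + 2) s =
    (d + 2) * (d + 1) * (s.choose (d + 2) : ℝ) - 2 * (d + 1) * (s.choose (d + 1) : ℝ)
      + 2 * (s.choose d : ℝ) := by
  have key : ∀ e : ℕ, (s.choose (e + 1) : ℝ) * (e + 1) = s.choose e * ((s : ℝ) - e) := by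
    intro e
    rcases le_or_gt e s with h | h
    · have := Nat.choose_succ_right_eq s e
      rw [← Nat.cast_sub h]
      exact_mod_cast this
    · simp [Nat.choose_eq_zero_of_lt h, Nat.choose_eq_zero_of_lt (h.trans (Nat.lt_succ_self e))]
  have h1 := key d
  have h2 := key (d + 1)
  simp only [dualPoly, Nat.add_sub_cancel]
  push_cast at *
  linear_combination -(d + 1) * h2 - ((s : ℝ) - d - 3) * h1

theorem dualPoly_nonneg (k s : ℕ) : 0 ≤ dualPoly k s := by
  unfold dualPoly
  rw [mul_assoc]
  refine mul_nonneg (by positivity) ?_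
  have : (0 : ℤ) ≤ ((s : ℤ) - k + 1) * ((s : ℤ) - k) := by
    rcases le_or_gt (k : ℤ) s with h | h <;> nlinarith
  exact_mod_cast this

theorem dualPoly_pos {k s : ℕ} (hks : k < s) : 0 < dualPoly k s := by
  unfold dualPoly
  have h : (k : ℝ) < s := by exact_mod_cast hks
  have := Nat.choose_pos (n := s) (k := k - 2) (by omega)
  have h1 : (0 : ℝ) < (s.choose (k - 2) : ℝ) := by exact_mod_cast this
  exact mul_pos (mul_pos h1 (by linarith)) (by linarith)

theorem sum_real_mul_dualPoly {n k : ℕ} {p : ℝ} {P : Measure (Fin n → Bool)} (hk : 2 ≤ k)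
    (hkn : k + 2 ≤ n) (hP : P ∈ kwiseLaws n k p) :
    ∑ x, P.real {x} * dualPoly k (ones x).card = dualPoly k n * secondValue n k p := by
  obtain ⟨d, rfl⟩ : ∃ d, k = d + 2 := ⟨k - 2, by omega⟩
  obtain ⟨t, rfl⟩ : ∃ t, n = d + 2 + 2 + t := ⟨n - (d + 2 + 2), by omega⟩
  have hle : d + 2 ≤ d + 2 + 2 + t := by omega
  have hterm : ∀ x : Fin (d + 2 + 2 + t) → Bool, P.real {x} * dualPoly (d + 2) (ones x).card =
      (d + 2) * (d + 1) * (P.real {x} * ((ones x).card.choose (d + 2) : ℝ)) -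
      2 * (d + 1) * (P.real {x} * ((ones x).card.choose (d + 1) : ℝ)) +
      2 * (P.real {x} * ((ones x).card.choose d : ℝ)) := fun x => by
    rw [dualPoly_add_two]; ring
  simp only [hterm]
  rw [Finset.sum_add_distrib, Finset.sum_sub_distrib, ← Finset.mul_sum, ← Finset.mul_sum,
    ← Finset.mul_sum, sum_real_mul_choose hle hP le_rfl, sum_real_mul_choose hle hP (by omega),
    sum_real_mul_choose hle hP (by omega)]
  have key : ∀ e : ℕ, e ≤ d + 2 + 2 + t → ((d + 2 + 2 + t).choose (e + 1) : ℝ) * (e + 1) =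
      (d + 2 + 2 + t).choose e * (((d + 2 + 2 + t : ℕ) : ℝ) - e) := by
    intro e he
    have := Nat.choose_succ_right_eq (d + 2 + 2 + t) e
    rw [← Nat.cast_sub he]
    exact_mod_cast this
  have h1 := key d (by omega)
  have h2 := key (d + 1) (by omega)
  have e1 : d + 2 + 2 + t - (d + 2) + 1 = t + 3 := by omega
  have e2 : d + 2 + 2 + t - (d + 2) + 2 = t + 4 := by omega
  rw [secondValue, e1, e2, bonferroni_two_right, Nat.cast_choose_two, dualPoly]
  simp only [Nat.add_sub_cancel]
  push_cast at *
  have ht : ((t : ℝ) + 3) * (t + 2) * (1 / (((t : ℝ) + 3) * (t + 3 - 1) / 2)) = 2 := by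
    have h3 : (t : ℝ) + 3 - 1 = t + 2 := by ring
    have : (0 : ℝ) ≤ t := Nat.cast_nonneg t
    rw [h3]
    field_simp
  generalize 1 / (((t : ℝ) + 3) * (t + 3 - 1) / 2) = c at *
  linear_combination ((d + 1) * p ^ 2 * p ^ d) * h2 + ((t + 3) * p ^ 2 * p ^ d - 2 * p * p ^ d) * h1
    - (((d + 2 + 2 + t).choose d : ℝ) * p ^ d *
      (1 - (t + 4) * p + (t + 4) * (t + 4 - 1) / 2 * p ^ 2)) * ht

theorem secondValue_eq_probAllOnes_add {n k : ℕ} {p : ℝ} {P : Measure (Fin n → Bool)} (hk : 2 ≤ k)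
    (hkn : k + 2 ≤ n) (hP : P ∈ kwiseLaws n k p) :
    dualPoly k n * secondValue n k p = dualPoly k n * probAllOnes P +
      ∑ x, if (ones x).card = n then 0 else P.real {x} * dualPoly k (ones x).card := by
  have := hP.1
  rw [← sum_real_mul_dualPoly hk hkn hP]
  have h1 : probAllOnes P = ∑ x, if (ones x).card = n then P.real {x} else 0 := by
    rw [probAllOnes, ← real_eq_sum]
    simp only [card_ones_eq_iff]
  rw [h1, Finset.mul_sum, ← Finset.sum_add_distrib]
  refine Finset.sum_congr rfl fun x _ => ?_
  split_ifs with h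
  · rw [h]; ring
  · ring

theorem probAllOnes_le_secondValue {n k : ℕ} {p : ℝ} {P : Measure (Fin n → Bool)} (hk : 2 ≤ k)
    (hkn : k + 2 ≤ n) (hP : P ∈ kwiseLaws n k p) : probAllOnes P ≤ secondValue n k p := by
  have h := secondValue_eq_probAllOnes_add hk hkn hP
  have hs : 0 ≤ ∑ x : Fin n → Bool,
      if (ones x).card = n then 0 else P.real {x} * dualPoly k (ones x).card := by
    refine Finset.sum_nonneg fun x _ => ?_
    split_ifs
    · exact le_rfl
    · exact mul_nonneg measureReal_nonneg (dualPoly_nonneg _ _)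
  have hpos : 0 < dualPoly k n := dualPoly_pos (by omega)
  exact le_of_mul_le_mul_left (by linarith) hpos

theorem cellProb_eq_zero_of_probAllOnes_eq {n k i : ℕ} {p : ℝ} {P : Measure (Fin n → Bool)}
    (hk : 2 ≤ k) (hkn : k + 2 ≤ n) (hP : P ∈ kwiseLaws n k p)
    (h : probAllOnes P = secondValue n k p) (hki : k < i) (hin : i < n) : cellProb P i = 0 := by
  have hsum := secondValue_eq_probAllOnes_add hk hkn hP
  rw [h, left_eq_add, Finset.sum_eq_zero_iff_of_nonneg] at hsum
  · have := hsum (initialOnes n i) (Finset.mem_univ _)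
    rw [card_ones_initialOnes hin.le, if_neg hin.ne, ← cellProb_eq, mul_eq_zero] at this
    exact this.resolve_right (dualPoly_pos hki).ne'
  · intro x _
    split_ifs
    · exact le_rfl
    · exact mul_nonneg measureReal_nonneg (dualPoly_nonneg _ _)

theorem cellProb_last {n : ℕ} (P : Measure (Fin n → Bool)) : cellProb P n = probAllOnes P := by
  simp [cellProb, probAllOnes]

/-- The second form holds exactly when the claimed cell probabilities are nonnegative. -/
theorem hasSecondForm_iff {n k : ℕ} (hk : 2 ≤ k) (hkn : k + 2 ≤ n) (p : ℝ) :
    HasSecondForm n k p ↔ ∀ i ≤ n, 0 ≤ secondCell n k p i := by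
  constructor
  · rintro ⟨-, P, -, -, hP, -⟩ i hi
    rw [← hP i hi]
    exact measureReal_nonneg
  · intro hv
    set P := cellLaw n (secondCell n k p) with hPdef
    have hmem : P ∈ kwiseLaws n k p := cellLaw_mem_kwiseLaws (by omega) hv
      fun j hj => sum_choose_mul_secondCell hk hkn p hj
    have hcell : ∀ i ≤ n, cellProb P i = secondCell n k p i := fun i hi => cellProb_cellLaw hv hi
    have hval : probAllOnes P = secondValue n k p := by
      rw [← cellProb_last, hcell n le_rfl, secondCell_last]
    have hopt : IsOptimizing n k p P :=
      ⟨hmem, fun Q hQ => hval ▸ probAllOnes_le_secondValue hk hkn hQ⟩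
    refine ⟨?_, P, hopt, isExchangeableLaw_cellLaw n _, hcell, fun Q hQ hQex => ?_⟩
    · refine IsGreatest.csSup_eq ⟨⟨P, hmem, hval⟩, ?_⟩
      rintro _ ⟨Q, hQ, rfl⟩
      exact probAllOnes_le_secondValue hk hkn hQ
    · have hQval : probAllOnes Q = secondValue n k p :=
        le_antisymm (probAllOnes_le_secondValue hk hkn hQ.1) (hval ▸ hQ.2 P hmem)
      refine exchangeable_eq_of_cellProb_eq (by omega) hQ.1 hQex hmem
        (isExchangeableLaw_cellLaw n _) fun i hi hki => ?_
      rcases hi.lt_or_eq with h | rfl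
      · rw [cellProb_eq_zero_of_probAllOnes_eq hk hkn hQ.1 hQval hki h,
          cellProb_eq_zero_of_probAllOnes_eq hk hkn hmem hval hki h]
      · rw [cellProb_last, cellProb_last, hQval, hval]

theorem bonferroni_succ_succ (m l : ℕ) (x : ℝ) : bonferroni (m + 1) (l + 1) x =
    (1 - x) * bonferroni m l x + (-1) ^ (l + 1) * (m.choose (l + 1) : ℝ) * x ^ (l + 1) := by
  induction l with
  | zero => simp [bonferroni, Finset.sum_range_succ]; ring
  | succ l ih =>
    rw [bonferroni_succ_right, ih, bonferroni_succ_right m l, Nat.choose_succ_succ m (l + 1)]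
    push_cast
    ring

/-- The cell probability at `k - (e + 2)`, divided by `p ^ (k - (e + 2)) * (1 - p)`. -/
noncomputable def reducedCell (a e : ℕ) (x : ℝ) : ℝ :=
  bonferroni (a + e + 1) (e + 1) x +
    (-1) ^ e * (2 * ((a + e + 1).choose (e + 2) : ℝ) / (a * (a + 1))) * x ^ e * ((a + 1) * x - 1)

theorem secondValue_add (k a : ℕ) (p : ℝ) : secondValue (k + a) k p =
    2 / (a * (a + 1)) * p ^ (k - 2) * (1 - (a + 2) * p + (a + 2) * (a + 1) / 2 * p ^ 2) := by
  rw [secondValue, Nat.add_sub_cancel_left, bonferroni_two_right, Nat.cast_choose_two]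
  push_cast
  rw [one_div_div]
  ring_nf

theorem secondCell_add_self {k a : ℕ} (hk : 2 ≤ k) (ha : 2 ≤ a) (p : ℝ) :
    secondCell (k + a) k p k = 2 / (a * (a + 1)) * p ^ (k - 2) * ((1 - p) * ((a + 1) * p - 1)) := by
  have ha0 : (a : ℝ) ≠ 0 := by positivity
  have ha1 : (a : ℝ) + 1 ≠ 0 := by positivity
  obtain ⟨d, rfl⟩ : ∃ d, k = d + 2 := ⟨k - 2, by omega⟩
  rw [secondCell_of_le hk (by omega) p le_rfl, Nat.sub_self, bonferroni_zero_right,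
    bonferroni_zero_right, secondValue_add, Nat.add_sub_cancel, pow_add]
  field_simp
  ring

theorem secondCell_add_pred {k a : ℕ} (hk : 2 ≤ k) (ha : 2 ≤ a) (p : ℝ) :
    secondCell (k + a) k p (k - 1) = p ^ (k - 2) * ((1 - p) * (2 / (a + 1) - p)) := by
  have ha0 : (a : ℝ) ≠ 0 := by positivity
  have ha1 : (a : ℝ) + 1 ≠ 0 := by positivity
  obtain ⟨d, rfl⟩ : ∃ d, k = d + 2 := ⟨k - 2, by omega⟩
  have e1 : d + 2 + a - (d + 2 - 1) = a + 1 := by omega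
  have e2 : d + 2 - (d + 2 - 1) = 0 + 1 := by omega
  have e3 : d + 2 - 1 = d + 1 := rfl
  rw [secondCell_of_le hk (by omega) p (by omega), e1, e2, bonferroni_succ_one,
    bonferroni_succ_right, bonferroni_zero_right, secondValue_add, Nat.add_sub_cancel, e3, pow_add]
  simp
  field_simp
  ring

theorem secondCell_add_sub {k a e : ℕ} (hk : e + 2 ≤ k) (ha : 2 ≤ a) (p : ℝ) :
    secondCell (k + a) k p (k - (e + 2)) =
      p ^ (k - (e + 2)) * ((1 - p) * reducedCell a e p) := by
  have ha0 : (a : ℝ) ≠ 0 := by positivity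
  have ha1 : (a : ℝ) + 1 ≠ 0 := by positivity
  obtain ⟨d, rfl⟩ : ∃ d, k = d + (e + 2) := ⟨k - (e + 2), by omega⟩
  have e1 : d + (e + 2) + a - d = a + e + 1 + 1 := by omega
  have e2 : d + (e + 2) - 2 = d + e := by omega
  rw [Nat.add_sub_cancel, secondCell_of_le (by omega) (by omega) p (by omega), e1,
    Nat.add_sub_cancel_left, bonferroni_succ_one, bonferroni_succ_succ, secondValue_add,
    reducedCell, e2]
  simp only [pow_add, pow_one]
  field_simp
  ring

theorem choose_ratio (a e : ℕ) : ((a + (e + 1) + 1).choose (e + 1 + 2) : ℝ) =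
    (a + e + 2) / (e + 3) * ((a + e + 1).choose (e + 2) : ℝ) := by
  have h := Nat.add_one_mul_choose_eq (a + e + 1) (e + 2)
  have h' : ((a : ℝ) + e + 2) * ((a + e + 1).choose (e + 2) : ℝ) =
      ((a + (e + 1) + 1).choose (e + 1 + 2) : ℝ) * (e + 3) := by
    have : a + (e + 1) + 1 = a + e + 1 + 1 := by omega
    rw [this]
    exact_mod_cast h
  field_simp
  linarith

theorem reducedCell_succ (a e : ℕ) (x : ℝ) : reducedCell a (e + 1) x =
    (1 - x) * reducedCell a e x + (-1) ^ e * (((a + e + 1).choose (e + 2) : ℝ) * x ^ e) *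
      (x ^ 2 - 2 * ((a + 1) * x - 1) / (a * (a + 1)) * ((a + e + 2) / (e + 3) * x + (1 - x))) := by
  have e1 : a + (e + 1) + 1 = a + e + 1 + 1 := by omega
  rw [reducedCell, choose_ratio, e1, bonferroni_succ_succ, reducedCell]
  simp only [pow_succ]
  ring

theorem reducedCell_zero {a : ℕ} (ha : 2 ≤ a) (x : ℝ) : reducedCell a 0 x = 0 := by
  have ha0 : (a : ℝ) ≠ 0 := by positivity
  have ha1 : (a : ℝ) + 1 ≠ 0 := by positivity
  simp [reducedCell, bonferroni, Finset.sum_range_succ, Nat.cast_choose_two]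
  field_simp
  ring

theorem reducedCell_one {a : ℕ} (ha : 2 ≤ a) (x : ℝ) : reducedCell a 1 x =
    1 - 2 * (a + 2) / 3 * x + (a + 1) * (a + 2) / 6 * x ^ 2 := by
  have ha0 : (a : ℝ) ≠ 0 := by positivity
  have ha1 : (a : ℝ) + 1 ≠ 0 := by positivity
  rw [reducedCell_succ, reducedCell_zero ha]
  simp [Nat.cast_choose_two]
  field_simp
  ring

theorem reducedCell_two {a : ℕ} (ha : 2 ≤ a) (x : ℝ) : reducedCell a 2 x =
    1 - (a + 3) * x + 5 / 12 * ((a + 3) * (a + 2)) * x ^ 2 -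
      1 / 12 * ((a + 3) * (a + 2) * (a + 1)) * x ^ 3 := by
  have ha0 : (a : ℝ) ≠ 0 := by positivity
  have ha1 : (a : ℝ) + 1 ≠ 0 := by positivity
  have hc := choose_ratio a 0
  simp only [zero_add, Nat.cast_zero, add_zero, Nat.cast_choose_two] at hc
  rw [reducedCell_succ, reducedCell_one ha, hc]
  push_cast
  field_simp
  ring

theorem secondCubic_add {k a : ℕ} (ha : 2 ≤ a) (x : ℝ) :
    secondCubic (k + a) k x = reducedCell a 2 x := by
  have h1 := Nat.add_one_mul_choose_eq (a + 2) 2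
  have h2 : ((a : ℝ) + 2 + 1) * ((a + 2).choose 2 : ℝ) = ((a + 2 + 1).choose 3 : ℝ) * (2 + 1) := by
    exact_mod_cast h1
  rw [Nat.cast_choose_two] at h2
  push_cast at h2
  rw [secondCubic, reducedCell_two ha, Nat.add_sub_cancel_left, Nat.choose_one_right,
    Nat.cast_choose_two]
  push_cast
  linear_combination (x ^ 3 / 6) * h2

theorem reducedCell_one_pos {a : ℕ} (ha : 2 ≤ a) (x : ℝ) : 0 < reducedCell a 1 x := by
  have ha' : (2 : ℝ) ≤ a := by exact_mod_cast ha
  rw [reducedCell_one ha]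
  have h : 3 * ((a : ℝ) + 1) * (1 - 2 * (a + 2) / 3 * x + (a + 1) * (a + 2) / 6 * x ^ 2) =
      (a + 2) / 2 * ((a + 1) * x - 2) ^ 2 + (a - 1) := by ring
  have h0 : 0 < 3 * ((a : ℝ) + 1) * (1 - 2 * (a + 2) / 3 * x + (a + 1) * (a + 2) / 6 * x ^ 2) := by
    rw [h]
    have : 0 ≤ ((a : ℝ) + 2) / 2 * ((a + 1) * x - 2) ^ 2 := by positivity
    linarith
  exact pos_of_mul_pos_right h0 (by positivity)

theorem reducedCell_two_strictAnti {a : ℕ} (ha : 2 ≤ a) : StrictAnti (reducedCell a 2) := by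
  intro x y hxy
  have ha' : (2 : ℝ) ≤ a := by exact_mod_cast ha
  rw [reducedCell_two ha, reducedCell_two ha, ← sub_pos]
  have h : 0 < 1 - 5 / 12 * ((a : ℝ) + 2) * (x + y) +
      1 / 12 * (a + 2) * (a + 1) * (x ^ 2 + x * y + y ^ 2) := by
    have h1 : 144 * ((a : ℝ) + 1) * (1 - 5 / 12 * ((a : ℝ) + 2) * (x + y) +
        1 / 12 * (a + 2) * (a + 1) * (x ^ 2 + x * y + y ^ 2)) =
        (a + 2) * (3 * (a + 1) * (x + y) - 10) ^ 2 + 3 * (a + 2) * (a + 1) ^ 2 * (x - y) ^ 2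
          + (44 * a - 56) := by ring
    refine pos_of_mul_pos_right (a := 144 * ((a : ℝ) + 1)) ?_ (by positivity)
    rw [h1]
    have h2 : 0 ≤ ((a : ℝ) + 2) * (3 * (a + 1) * (x + y) - 10) ^ 2 +
      3 * (a + 2) * (a + 1) ^ 2 * (x - y) ^ 2 := by positivity
    linarith
  nlinarith [mul_pos (mul_pos (sub_pos.2 hxy) h) (by positivity : (0 : ℝ) < a + 3)]

theorem odd_step_nonneg {a e x : ℝ} (ha : 1 ≤ a) (he : 1 ≤ e) (hx : 1 ≤ (a + 1) * x) :
    0 ≤ x ^ 2 - 2 * ((a + 1) * x - 1) / (a * (a + 1)) * ((a + e + 2) / (e + 3) * x + (1 - x)) := by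
  have hx0 : 0 ≤ x := by nlinarith
  have hr : (a + e + 2) / (e + 3) ≤ (a + 3) / 4 := by
    rw [div_le_div_iff₀ (by linarith) (by norm_num)]
    nlinarith
  have hd : 0 ≤ 2 * ((a + 1) * x - 1) / (a * (a + 1)) :=
    div_nonneg (by linarith) (by positivity)
  have h1 : 0 ≤ x ^ 2 - 2 * ((a + 1) * x - 1) / (a * (a + 1)) * ((a + 3) / 4 * x + (1 - x)) := by
    have e1 : x ^ 2 - 2 * ((a + 1) * x - 1) / (a * (a + 1)) * ((a + 3) / 4 * x + (1 - x)) =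
        (2 * a * (a - 1) * x ^ 2 - 6 * (a - 1) * (x * (1 - x)) + 8 * (1 - x) ^ 2) /
          (4 * (a * (a + 1))) := by
      field_simp
      ring
    rw [e1]
    refine div_nonneg ?_ (by positivity)
    have e2 : 2 * a * (a - 1) * x ^ 2 - 6 * (a - 1) * (x * (1 - x)) + 8 * (1 - x) ^ 2 =
        1 / 8 * (8 * (1 - x) - 3 * (a - 1) * x) ^ 2 + (7 * a + 9) * (a - 1) / 8 * x ^ 2 := by
      ring
    rw [e2]
    have : 0 ≤ a - 1 := by linarith
    positivity
  refine h1.trans (sub_le_sub_left (mul_le_mul_of_nonneg_left ?_ hd) _)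
  gcongr

theorem even_step_nonneg {a r s x : ℝ} (ha : 2 ≤ a) (hr1 : 1 ≤ r) (hr : r ≤ (a + 4) / 5)
    (hs : 1 ≤ s) (hx : 1 ≤ (a + 1) * x) (hx2 : (a + 2) * x ≤ 2)
    (hc : 0 ≤ 1 - (a + 3) * x + 5 / 12 * ((a + 3) * (a + 2)) * x ^ 2 -
      1 / 12 * ((a + 3) * (a + 2) * (a + 1)) * x ^ 3) :
    0 ≤ (1 - x) * x ^ 2 - r * x ^ 3 +
      2 * ((a + 1) * x - 1) / (a * (a + 1)) * (r * s * x ^ 2 - (1 - x) ^ 2) := by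
  have hx0 : 0 ≤ x := by nlinarith
  set d := 2 * ((a + 1) * x - 1) / (a * (a + 1)) with hd
  have hd' : d * (a * (a + 1)) = 2 * ((a + 1) * x - 1) := by rw [hd]; field_simp
  have hd0 : 0 ≤ d := div_nonneg (by linarith) (by positivity)
  have hdx : d ≤ x := by
    rw [hd, div_le_iff₀ (by positivity)]
    nlinarith [mul_nonneg hx0 (by linarith : 0 ≤ a - 2), mul_nonneg (mul_nonneg hx0 (by linarith : 0 ≤ a - 2)) (by linarith : (0 : ℝ) ≤ a)]
  have hq : (a - 1) * x ^ 2 ≤ (1 - x) ^ 2 := by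
    have h1 : (a * x) ^ 2 ≤ (2 * (1 - x)) ^ 2 :=
      pow_le_pow_left₀ (by positivity) (by linarith) 2
    nlinarith [mul_nonneg (sq_nonneg x) (sq_nonneg (a - 2))]
  have hmain : 0 ≤ (1 - x) * x ^ 2 - d * (1 - x) ^ 2 - (a + 4) / 5 * (x ^ 2 * (x - d)) := by
    have h1 : 0 ≤ ((a + 1) * x - 1) * ((1 - x) ^ 2 - (a - 1) * x ^ 2) :=
      mul_nonneg (by linarith) (by linarith)
    have h2 : 5 * (a * (a + 1)) *
        ((1 - x) * x ^ 2 - d * (1 - x) ^ 2 - (a + 4) / 5 * (x ^ 2 * (x - d))) =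
        12 * (1 - (a + 3) * x + 5 / 12 * ((a + 3) * (a + 2)) * x ^ 2 -
          1 / 12 * ((a + 3) * (a + 2) * (a + 1)) * x ^ 3) +
        2 * (((a + 1) * x - 1) * ((1 - x) ^ 2 - (a - 1) * x ^ 2)) := by
      linear_combination (-5 * (1 - x) ^ 2 + (a + 4) * x ^ 2) * hd'
    exact nonneg_of_mul_nonneg_right (by rw [h2]; linarith : 0 ≤ 5 * (a * (a + 1)) * _)
      (by positivity)
  have h3 : r * (x ^ 2 * (x - d)) ≤ (a + 4) / 5 * (x ^ 2 * (x - d)) :=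
    mul_le_mul_of_nonneg_right hr (mul_nonneg (sq_nonneg x) (by linarith))
  have h4 : 0 ≤ d * (r * x ^ 2) * (s - 1) :=
    mul_nonneg (mul_nonneg hd0 (mul_nonneg (by linarith) (sq_nonneg x))) (by linarith)
  nlinarith

theorem reducedCell_add_two_of_even (a : ℕ) {e : ℕ} (he : Even e) (x : ℝ) :
    reducedCell a (e + 2) x = (1 - x) ^ 2 * reducedCell a e x +
      ((a + e + 1).choose (e + 2) : ℝ) * x ^ e *
        ((1 - x) * x ^ 2 - (a + e + 2) / (e + 3) * x ^ 3 +
          2 * ((a + 1) * x - 1) / (a * (a + 1)) *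
          ((a + e + 2) / (e + 3) * ((a + e + 3) / (e + 4)) * x ^ 2 - (1 - x) ^ 2)) := by
  have f1 : (a : ℝ) + (e + 1) + 2 = a + e + 3 := by ring
  have f2 : (e : ℝ) + 1 + 3 = e + 4 := by ring
  rw [reducedCell_succ, reducedCell_succ, choose_ratio, he.add_one.neg_one_pow, he.neg_one_pow,
    pow_succ x e]
  push_cast
  rw [f1, f2]
  ring

theorem reducedCell_even_nonneg {a : ℕ} (ha : 2 ≤ a) {x : ℝ} (hx : 1 ≤ ((a : ℝ) + 1) * x)
    (hx2 : ((a : ℝ) + 2) * x ≤ 2) (hc : 0 ≤ reducedCell a 2 x) (i : ℕ) :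
    0 ≤ reducedCell a (2 * i + 2) x := by
  have ha' : (2 : ℝ) ≤ a := by exact_mod_cast ha
  have hx0 : 0 ≤ x := by nlinarith
  induction i with
  | zero => exact hc
  | succ i ih =>
    have hi : (0 : ℝ) ≤ i := Nat.cast_nonneg i
    rw [show 2 * (i + 1) + 2 = 2 * i + 2 + 2 by ring,
      reducedCell_add_two_of_even a ⟨i + 1, by ring⟩]
    refine add_nonneg (mul_nonneg (sq_nonneg _) ih) (mul_nonneg (by positivity) ?_)
    push_cast
    refine even_step_nonneg ha' ?_ ?_ ?_ hx hx2 (by rwa [← reducedCell_two ha])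
    · rw [one_le_div (by positivity)]; linarith
    · rw [div_le_div_iff₀ (by positivity) (by norm_num)]; nlinarith
    · rw [one_le_div (by positivity)]; linarith

theorem reducedCell_nonneg {a : ℕ} (ha : 2 ≤ a) {x : ℝ} (hx : 1 ≤ ((a : ℝ) + 1) * x)
    (hx2 : ((a : ℝ) + 2) * x ≤ 2) (hc : 0 ≤ reducedCell a 2 x) (e : ℕ) :
    0 ≤ reducedCell a e x := by
  have ha' : (2 : ℝ) ≤ a := by exact_mod_cast ha
  have hx0 : 0 ≤ x := by nlinarith
  rcases Nat.even_or_odd e with he | he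
  · rcases Nat.eq_zero_or_pos e with rfl | hpos
    · rw [reducedCell_zero ha]
    · obtain ⟨i, rfl⟩ : ∃ i, e = 2 * i + 2 := by
        obtain ⟨r, rfl⟩ := he
        exact ⟨r - 1, by omega⟩
      exact reducedCell_even_nonneg ha hx hx2 hc i
  · have hnext : 0 ≤ reducedCell a (e + 1) x := by
      obtain ⟨r, rfl⟩ := he
      exact reducedCell_even_nonneg ha hx hx2 hc r
    have he1 : (1 : ℝ) ≤ e := by exact_mod_cast he.pos
    have hstep := odd_step_nonneg (by linarith : (1 : ℝ) ≤ a) he1 hx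
    have hmul := mul_nonneg
      (by positivity : 0 ≤ ((a + e + 1).choose (e + 2) : ℝ) * x ^ e) hstep
    rw [reducedCell_succ, he.neg_one_pow] at hnext
    have hx1 : 0 < 1 - x := by nlinarith
    refine nonneg_of_mul_nonneg_right (?_ : 0 ≤ (1 - x) * reducedCell a e x) hx1
    linarith

theorem secondCell_nonneg {k a : ℕ} (hk : 2 ≤ k) (ha : 2 ≤ a) {p : ℝ}
    (hp1 : 1 / ((a : ℝ) + 1) ≤ p) (hp2 : p ≤ 2 / ((a : ℝ) + 1))
    (hred : ∀ e, e + 2 ≤ k → 0 ≤ reducedCell a e p) :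
    ∀ i ≤ k + a, 0 ≤ secondCell (k + a) k p i := by
  have ha' : (2 : ℝ) ≤ a := by exact_mod_cast ha
  have hp0 : 0 ≤ p := le_trans (by positivity) hp1
  have hp1' : 0 ≤ (a + 1) * p - 1 := by
    rw [div_le_iff₀ (by positivity)] at hp1; linarith
  have hq : 0 ≤ 1 - p := by
    have : 2 / ((a : ℝ) + 1) ≤ 1 := by rw [div_le_one (by positivity)]; linarith
    linarith
  intro i hi
  rcases hi.lt_or_eq with hi | rfl
  · rcases lt_trichotomy i k with hik | rfl | hik
    · rcases Nat.lt_or_ge (i + 1) k with h1 | h1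
      · obtain ⟨e, rfl⟩ : ∃ e, k = i + (e + 2) := ⟨k - i - 2, by omega⟩
        have := secondCell_add_sub (k := i + (e + 2)) (e := e) (by omega) ha p
        rw [Nat.add_sub_cancel] at this
        rw [this]
        exact mul_nonneg (pow_nonneg hp0 _) (mul_nonneg hq (hred e (by omega)))
      · obtain rfl : i = k - 1 := by omega
        rw [secondCell_add_pred hk ha]
        exact mul_nonneg (pow_nonneg hp0 _) (mul_nonneg hq (by linarith))
    · rw [secondCell_add_self hk ha]
      exact mul_nonneg (by positivity) (mul_nonneg hq hp1')
    · rw [secondCell_of_lt hk p hik hi]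
  · rw [secondCell_last, secondValue_add]
    refine mul_nonneg (by positivity) ?_
    have h : 2 * (a + 1) * (1 - ((a : ℝ) + 2) * p + (a + 2) * (a + 1) / 2 * p ^ 2) =
        (a + 2) * ((a + 1) * p - 1) ^ 2 + a := by ring
    exact nonneg_of_mul_nonneg_right (by rw [h]; positivity) (by positivity : 0 < 2 * ((a : ℝ) + 1))

theorem isGreatest_secondEnds {k a : ℕ} (hk : 2 ≤ k) (ha : 2 ≤ a) {q : ℝ}
    (hq1 : 1 / ((a : ℝ) + 1) < q) (hq : q < 1)
    (hnonneg : ∀ p ∈ Set.Icc (1 / ((a : ℝ) + 1)) q, ∀ i ≤ k + a, 0 ≤ secondCell (k + a) k p i)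
    (hneg : ∀ p ∈ Set.Ioo q 1, ∃ i ≤ k + a, secondCell (k + a) k p i < 0) :
    IsGreatest (secondEnds (k + a) k) q := by
  have hcast : ((k + a : ℕ) : ℝ) - k + 1 = a + 1 := by push_cast; ring
  constructor
  · refine ⟨by rwa [hcast], fun p hp => ?_⟩
    rw [hcast] at hp
    exact (hasSecondForm_iff hk (by omega) p).2 (hnonneg p hp)
  · rintro r ⟨-, hr⟩
    rw [hcast] at hr
    by_contra! hqr
    obtain ⟨p, hqp, hpr⟩ := exists_between (lt_min hqr hq)
    obtain ⟨i, hi, hlt⟩ := hneg p ⟨hqp, hpr.trans_le (min_le_right _ _)⟩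
    have hform := hr p ⟨(hq1.trans hqp).le, (hpr.trans_le (min_le_left _ _)).le⟩
    exact hlt.not_ge ((hasSecondForm_iff hk (by omega) p).1 hform i hi)

theorem isGreatest_secondEnds_of_le_three {k a : ℕ} (hk : 2 ≤ k) (hk3 : k ≤ 3) (ha : 2 ≤ a) :
    IsGreatest (secondEnds (k + a) k) (2 / ((a : ℝ) + 1)) := by
  have ha' : (2 : ℝ) ≤ a := by exact_mod_cast ha
  refine isGreatest_secondEnds hk ha ?_ ?_ ?_ ?_
  · gcongr; norm_num
  · rw [div_lt_one (by positivity)]; linarith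
  · intro p hp
    refine secondCell_nonneg hk ha hp.1 hp.2 fun e he => ?_
    obtain rfl | rfl : e = 0 ∨ e = 1 := by omega
    · rw [reducedCell_zero ha]
    · exact (reducedCell_one_pos ha p).le
  · intro p hp
    refine ⟨k - 1, by omega, ?_⟩
    have hp0 : 0 < p := lt_trans (by positivity) hp.1
    rw [secondCell_add_pred hk ha]
    exact mul_neg_of_pos_of_neg (pow_pos hp0 _)
      (mul_neg_of_pos_of_neg (by linarith [hp.2]) (by linarith [hp.1]))

theorem exists_secondCubic_zero {k a : ℕ} (hk : 4 ≤ k) (ha : 2 ≤ a) :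
    ∃ q ∈ Set.Icc (1 / ((a : ℝ) + 1)) (2 / ((a : ℝ) + 1)),
      secondCubic (k + a) k q = 0 ∧
      (∀ r ∈ Set.Icc (1 / ((a : ℝ) + 1)) (2 / ((a : ℝ) + 1)),
        secondCubic (k + a) k r = 0 → r = q) ∧
      IsGreatest (secondEnds (k + a) k) q := by
  have ha' : (2 : ℝ) ≤ a := by exact_mod_cast ha
  have hanti := reducedCell_two_strictAnti ha
  have hcont : Continuous (reducedCell a 2) := by
    have : reducedCell a 2 = fun x : ℝ => 1 - ((a : ℝ) + 3) * x +
        5 / 12 * ((a + 3) * (a + 2)) * x ^ 2 - 1 / 12 * ((a + 3) * (a + 2) * (a + 1)) * x ^ 3 :=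
      funext (reducedCell_two ha)
    rw [this]
    fun_prop
  have hleft : 0 < reducedCell a 2 (1 / ((a : ℝ) + 1)) := by
    have h : reducedCell a 2 (1 / ((a : ℝ) + 1)) = a * (a - 1) / (3 * (a + 1) ^ 2) := by
      rw [reducedCell_two ha]; field_simp; ring
    rw [h]
    exact div_pos (mul_pos (by linarith) (by linarith)) (by positivity)
  have hright : reducedCell a 2 (2 / ((a : ℝ) + 2)) < 0 := by
    have h : reducedCell a 2 (2 / ((a : ℝ) + 2)) = -(a / (3 * (a + 2) ^ 2)) := by
      rw [reducedCell_two ha]; field_simp; ring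
    rw [h]
    exact neg_neg_of_pos (by positivity)
  have hle : 1 / ((a : ℝ) + 1) ≤ 2 / (a + 2) := by
    rw [div_le_div_iff₀ (by positivity) (by positivity)]; linarith
  obtain ⟨q, hq, hq0⟩ := intermediate_value_Icc' hle hcont.continuousOn ⟨hright.le, hleft.le⟩
  have hq1 : 1 / ((a : ℝ) + 1) < q := hq.1.lt_of_ne fun h => by rw [h, hq0] at hleft; exact hleft.false
  have hq2 : q ≤ 2 / ((a : ℝ) + 1) := hq.2.trans (by gcongr; norm_num)
  refine ⟨q, ⟨hq.1, hq2⟩, by rw [secondCubic_add ha, hq0], fun r _ hr => ?_, ?_⟩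
  · rw [secondCubic_add ha] at hr
    exact hanti.injective (hr.trans hq0.symm)
  · refine isGreatest_secondEnds (by omega) ha hq1 ?_ ?_ ?_
    · refine hq2.trans_lt ?_
      rw [div_lt_one (by positivity)]; linarith
    · intro p hp
      refine secondCell_nonneg (by omega) ha hp.1 (hp.2.trans hq2) fun e _ => ?_
      refine reducedCell_nonneg ha ?_ ?_ ?_ e
      · have := hp.1
        rwa [div_le_iff₀' (by positivity)] at this
      · have := hp.2.trans hq.2
        rwa [le_div_iff₀' (by positivity)] at this
      · rw [← hq0]; exact hanti.antitone hp.2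
    · intro p hp
      refine ⟨k - (2 + 2), by omega, ?_⟩
      have hp0 : 0 < p := lt_trans (lt_trans (by positivity) hq1) hp.1
      have hneg : reducedCell a 2 p < 0 := hq0 ▸ hanti hp.1
      rw [secondCell_add_sub hk ha]
      exact mul_neg_of_pos_of_neg (pow_pos hp0 _)
        (mul_neg_of_pos_of_neg (by linarith [hp.2]) hneg)

theorem theorem4 (n k : ℕ) (hk : 2 ≤ k) (hkn : k + 2 ≤ n) :
    (∃ p₂ : ℝ, 1 / ((n : ℝ) - k + 1) < p₂ ∧
      ∀ p ∈ Set.Icc (1 / ((n : ℝ) - k + 1)) p₂, HasSecondForm n k p) ∧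
    (k = 2 → IsGreatest (secondEnds n k) (2 / ((n : ℝ) - 1))) ∧
    (k = 3 → IsGreatest (secondEnds n k) (2 / ((n : ℝ) - 2))) ∧
    (4 ≤ k → ∃ p₂ ∈ Set.Icc (1 / ((n : ℝ) - k + 1)) (2 / ((n : ℝ) - k + 1)),
      secondCubic n k p₂ = 0 ∧
      (∀ q ∈ Set.Icc (1 / ((n : ℝ) - k + 1)) (2 / ((n : ℝ) - k + 1)),
        secondCubic n k q = 0 → q = p₂) ∧
      IsGreatest (secondEnds n k) p₂) := by
  obtain ⟨a, rfl⟩ : ∃ a, n = k + a := ⟨n - k, by omega⟩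
  have ha : 2 ≤ a := by omega
  have hcast : ((k + a : ℕ) : ℝ) - k + 1 = a + 1 := by push_cast; ring
  refine ⟨?_, ?_, ?_, ?_⟩
  · obtain ⟨q, hq⟩ : ∃ q, q ∈ secondEnds (k + a) k := by
      rcases Nat.lt_or_ge k 4 with h | h
      · exact ⟨_, (isGreatest_secondEnds_of_le_three hk (by omega) ha).1⟩
      · obtain ⟨q, -, -, -, hq⟩ := exists_secondCubic_zero h ha
        exact ⟨q, hq.1⟩
    exact ⟨q, hq⟩
  · rintro rfl
    have e : ((2 + a : ℕ) : ℝ) - 1 = a + 1 := by push_cast; ring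
    rw [e]
    exact isGreatest_secondEnds_of_le_three hk (by norm_num) ha
  · rintro rfl
    have e : ((3 + a : ℕ) : ℝ) - 2 = a + 1 := by push_cast; ring
    rw [e]
    exact isGreatest_secondEnds_of_le_three hk le_rfl ha
  · intro h
    rw [hcast]
    exact exists_secondCubic_zero h ha
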